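/- Let $\mathbb{D}=\{z\in\mathbb{C}:|z|<1\}$, $\mathbb{T}=\{z\in\mathbb{C}:|z|=1\}$ and $\mathbb{E}=\{z\in\mathbb{C}:|z|>1\}$. A non-empty set $V\subset\mathbb{C}^2$ is called a *distinguished variety* if there is a polynomial $p\in\mathbb{C}[z,w]$ with $V=\{(z,w)\in\mathbb{D}^2:p(z,w)=0\}$, and if $\overline{V}\cap\partial(\mathbb{D}^2)=\overline{V}\cap(\partial\mathbb{D})^2$. The degree of $p\in\mathbb{C}[z,w]$ is the pair $(n,m)$, where $n$ is the degree of $p$ in $z$ and $m$ its degree in $w$; such pairs are ordered componentwise. (1) Let $V$ be a distinguished variety and let $p\in\mathbb{C}[z,w]$ satisfy $V=\{(z,w)\in\mathbb{D}^2:p(z,w)=0\}$, with the degree $(n,m)$ of $p$ minimal among the degrees of all polynomials that define $V$ in this way. Then $$\{(z,w)\in\mathbb{C}^2:p(z,w)=0\}\subset\mathbb{D}^2\cup\mathbb{T}^2\cup\mathbb{E}^2 .$$ (2) Conversely, let $p\in\mathbb{C}[z,w]$ be a polynomial whose zero set $W=\{(z,w)\in\mathbb{C}^2:p(z,w)=0\}$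 is non-empty and satisfies $W\subset\mathbb{D}^2\cup\mathbb{T}^2\cup\mathbb{E}^2$. Then $W\cap\mathbb{D}^2$ is a distinguished variety; in particular it is non-empty. -/

import Mathlib

open MvPolynomial

namespace DistVar

/-- The open unit disk in the complex plane. -/
def disk : Set ℂ := Metric.ball 0 1

/-- The unit circle in the complex plane. -/
def circle : Set ℂ := Metric.sphere 0 1

/-- The exterior of the closed unit disk in the complex plane. -/
def exterior : Set ℂ := (Metric.closedBall 0 1)ᶜ

/-- The open unit bidisk in `ℂ²`. -/
def bidisk : Set (ℂ × ℂ) := disk ×ˢ disk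

/-- The zero set in `ℂ²` of a polynomial `p(z, w)`; `X 0` is `z` and `X 1` is `w`. -/
def zeroSet (p : MvPolynomial (Fin 2) ℂ) : Set (ℂ × ℂ) :=
  {x | eval ![x.1, x.2] p = 0}

/-- The degree `(n, m)` of `p`: `n` is its degree in `z` and `m` its degree in `w`.
Pairs are ordered componentwise. -/
noncomputable def bidegree (p : MvPolynomial (Fin 2) ℂ) : ℕ × ℕ :=
  (p.degreeOf 0, p.degreeOf 1)

/-- `p` cuts out the set `V` in the bidisk. -/
def CutsOut (p : MvPolynomial (Fin 2) ℂ) (V : Set (ℂ × ℂ)) : Prop :=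
  V = {x ∈ bidisk | x ∈ zeroSet p}

/-- A distinguished variety: a nonempty set cut out in the bidisk by a polynomial, which exits
the bidisk through the distinguished boundary. (The closed bidisk is closed in `ℂ²`, so the
closure may be taken in `ℂ²`.) -/
def IsDistinguishedVariety (V : Set (ℂ × ℂ)) : Prop :=
  V.Nonempty ∧ (∃ p, CutsOut p V) ∧
    closure V ∩ frontier bidisk = closure V ∩ (frontier disk ×ˢ frontier disk)

/-- `p` cuts out `V`, and its degree `(n, m)` is minimal, for the componentwise order, among the
degrees of all polynomials cutting out `V`: if `q` also cuts out `V` and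
`bidegree q ≤ bidegree p`, then `bidegree p ≤ bidegree q`. -/
def CutsOutMinimally (p : MvPolynomial (Fin 2) ℂ) (V : Set (ℂ × ℂ)) : Prop :=
  MinimalFor (fun q => CutsOut q V) bidegree p

end DistVar

/-! Part (1) reduces to an irreducible factor `P`: minimality of the degree forces every irreducible
factor to vanish somewhere in the bidisk, and its zeros there still exit through the torus. For |z|
< 1 no zero of P(z,·) lies on the circle, so the number N of its zeros in the disc is constant. The
heart is N ≥ deg_w P (`natDegree_le_card_discRoots`): all zeros above the disc then lie in the
bidisk, and exchanging the variables and continuity of zeros give the rest.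

For this inequality, let w_i(z) be the zeros in the disc and a(z) = P(z,0). On the zero set a/w
agrees with a polynomial in (z,w), so the power sums Σ (a/w_i)^j are holomorphic. As |w_i| → 1 at
the boundary, they are asymptotic to a^j times the conjugate of Σ w_i^j. Comparing Fourier
coefficients shows that they are polynomials in z (`exists_polynomial_eqOn`). A Hankel system in
these polynomials yields a relation Σ_{j≤N} c_j (a/w)^j = 0 on the zeros in the disc. Clearing
denominators gives G ≠ 0 of degree at most N in w, with a zero in common with `P` above every point
of the disc. This is impossible if N < deg_w P, since `P` is irreducible.

In part (2), the boundary condition holds because the zero set is closed. Without zeros in the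
bidisk, P(z,·) would have no root for |z| < 1, so `P` would depend on z alone and vanish on a whole
line {z} × ℂ. -/

namespace DistVar

open Polynomial Metric Filter Topology

open scoped Polynomial.Bivariate

/-! ### Bivariate polynomials and continuity of their zeros. -/

section Bivariate

theorem evalEval_swap (z w : ℂ) (P : ℂ[X][Y]) :
    (Bivariate.swap P).evalEval z w = P.evalEval w z := by
  have := Bivariate.aevalAeval_swap z w P
  rwa [coe_aevalAeval_eq_evalEval, coe_aevalAeval_eq_evalEval] at this

/-- The polynomial `P(z, ·)`. -/
noncomputable def slice (P : ℂ[X][Y]) (z : ℂ) : ℂ[X] := P.map (evalRingHom z)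

@[simp] theorem eval_slice (P : ℂ[X][Y]) (z w : ℂ) : (slice P z).eval w = P.evalEval z w :=
  map_evalRingHom_eval z w P

theorem eval_derivative_slice (P : ℂ[X][Y]) (z w : ℂ) :
    (derivative (slice P z)).eval w = (derivative P).evalEval z w := by
  rw [slice, derivative_map]
  exact map_evalRingHom_eval z w _

theorem continuous_evalEval (P : ℂ[X][Y]) : Continuous fun x : ℂ × ℂ => P.evalEval x.1 x.2 := by
  induction P using Polynomial.induction_on' with
  | add p q hp hq => simpa using! hp.add hq
  | monomial n a =>
    simp only [← Polynomial.C_mul_X_pow_eq_monomial, evalEval_mul, evalEval_C, evalEval_pow, evalEval_X]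
    exact (a.continuous.comp continuous_fst).mul (continuous_snd.pow n)

theorem hasDerivAt_evalEval_left (P : ℂ[X][Y]) (z w : ℂ) :
    HasDerivAt (fun z => P.evalEval z w)
      ((Bivariate.swap (derivative (Bivariate.swap P))).evalEval z w) z := by
  have h := (slice (Bivariate.swap P) w).hasDerivAt z
  simpa only [eval_slice, eval_derivative_slice, evalEval_swap] using h

/-- Zeros of `P(z, ·)` depend continuously on `z`, as long as `P(z₀, ·)` is not zero. -/
theorem exists_zero_near {P : ℂ[X][Y]} {z₀ w₀ : ℂ} (hne : slice P z₀ ≠ 0)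
    (h0 : P.evalEval z₀ w₀ = 0) {ε : ℝ} (hε : 0 < ε) :
    ∀ᶠ z in 𝓝 z₀, ∃ w, dist w w₀ < ε ∧ P.evalEval z w = 0 := by
  obtain ⟨r, hr, hrε, hroot⟩ : ∃ r, 0 < r ∧ r < ε ∧ ∀ w ∈ sphere w₀ r, P.evalEval z₀ w ≠ 0 := by
    have hfin : ((slice P z₀).roots.toFinset.image fun w => dist w w₀ : Set ℝ).Finite :=
      Finset.finite_toSet _
    obtain ⟨r, hr, hr'⟩ := ((Set.Ioo_infinite hε).sdiff hfin).nonempty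
    refine ⟨r, hr.1, hr.2, fun w hw h => hr' ?_⟩
    simp only [Finset.coe_image, Set.mem_image, Finset.mem_coe, Multiset.mem_toFinset]
    exact ⟨w, (mem_roots hne).2 (by simpa [IsRoot] using h), hw⟩
  obtain ⟨μ, hμ, hμb⟩ : ∃ μ > 0, ∀ w ∈ sphere w₀ r, μ < ‖P.evalEval z₀ w‖ := by
    have hc : ContinuousOn (fun w => ‖P.evalEval z₀ w‖) (sphere w₀ r) :=
      ((continuous_evalEval P).comp (by fun_prop : Continuous fun w : ℂ => (z₀, w))).norm.continuousOn
    obtain ⟨x, hx, hmin⟩ := (isCompact_sphere w₀ r).exists_isMinOn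
      (NormedSpace.sphere_nonempty.2 hr.le) hc
    have hpos := norm_pos_iff.2 (hroot x hx)
    exact ⟨_, half_pos hpos, fun w hw => (half_lt_self hpos).trans_le (hmin hw)⟩
  have h1 : ∀ᶠ z in 𝓝 z₀, ∀ w ∈ sphere w₀ r, μ < ‖P.evalEval z w‖ := by
    have := (isCompact_sphere w₀ r).eventually_forall_of_forall_eventually (x₀ := z₀)
      (P := fun z w => μ < ‖P.evalEval z w‖)
      fun w hw => (continuous_evalEval P).norm.continuousAt.eventually (lt_mem_nhds (hμb w hw))
    exact this
  have h2 : ∀ᶠ z in 𝓝 z₀, ‖P.evalEval z w₀‖ < μ / 4 := by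
    have hc : Continuous fun z => ‖P.evalEval z w₀‖ :=
      ((continuous_evalEval P).comp (by fun_prop : Continuous fun z : ℂ => (z, w₀))).norm
    exact hc.continuousAt.eventually (gt_mem_nhds (by simpa [h0] using by positivity))
  filter_upwards [h1, h2] with z hz1 hz2
  have hd : Differentiable ℂ fun w => P.evalEval z w := by
    simpa using (slice P z).differentiable
  have hb : ∀ w ∈ sphere w₀ r, μ / 2 ≤ ‖P.evalEval z w - P.evalEval z w₀‖ := fun w hw => by
    have := norm_sub_norm_le (P.evalEval z w) (P.evalEval z w₀)
    linarith [hz1 w hw]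
  have hfreq : ∃ᶠ w in 𝓝 w₀, P.evalEval z w ≠ P.evalEval z w₀ := by
    intro hcon
    have heq : slice P z = Polynomial.C (P.evalEval z w₀) := by
      refine Polynomial.eq_of_infinite_eval_eq _ _
        ((infinite_of_mem_nhds w₀ hcon).mono fun w hw => ?_)
      simpa using hw
    obtain ⟨w, hw⟩ : (sphere w₀ r).Nonempty := NormedSpace.sphere_nonempty.2 hr.le
    have := hb w hw
    rw [← eval_slice P z w, heq] at this
    simp at this
    linarith
  -- Quantitative open mapping: the image contains the ball of radius μ/4 about P(z,w₀), hence 0.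
  obtain ⟨w, hw, hw0⟩ := hd.diffContOnCl.ball_subset_image_closedBall hr hb hfreq
    (show (0 : ℂ) ∈ _ by simp; linarith)
  exact ⟨w, (mem_closedBall.1 hw).trans_lt hrε, hw0⟩

end Bivariate

/-! ### Circle averages and boundary asymptotics of holomorphic functions. -/

section Analysis

/-- Holomorphic dependence of a circle average on a parameter. -/
theorem differentiableOn_circleAverage {U : Set ℂ} (hU : IsOpen U) {F F' : ℂ → ℂ → ℂ}
    {c : ℂ} {R : ℝ} (hF : ContinuousOn (fun x : ℂ × ℂ => F x.1 x.2) (U ×ˢ sphere c |R|))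
    (hF' : ContinuousOn (fun x : ℂ × ℂ => F' x.1 x.2) (U ×ˢ sphere c |R|))
    (hd : ∀ z ∈ U, ∀ w ∈ sphere c |R|, HasDerivAt (fun z => F z w) (F' z w) z) :
    DifferentiableOn ℂ (fun z => Real.circleAverage (F z) c R) U := by
  intro z₀ hz₀
  obtain ⟨ρ, hρ, hρU⟩ := nhds_basis_closedBall.mem_iff.1 (hU.mem_nhds hz₀)
  obtain ⟨M, hM⟩ := ((isCompact_closedBall z₀ ρ).prod (isCompact_sphere c |R|)).exists_bound_of_continuousOn
    (hF'.mono (Set.prod_mono hρU subset_rfl))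
  have hcont : ∀ G : ℂ → ℂ → ℂ, ContinuousOn (fun x : ℂ × ℂ => G x.1 x.2) (U ×ˢ sphere c |R|) →
      ∀ z ∈ U, Continuous fun θ => G z (circleMap c R θ) := fun G hG z hz =>
    hG.comp_continuous (f := fun θ => (z, circleMap c R θ)) (by fun_prop)
      fun θ => ⟨hz, circleMap_mem_sphere' c R θ⟩
  have key := (intervalIntegral.hasDerivAt_integral_of_dominated_loc_of_deriv_le
    (μ := MeasureTheory.volume) (a := 0) (b := 2 * Real.pi)
    (F := fun z θ => F z (circleMap c R θ)) (F' := fun z θ => F' z (circleMap c R θ))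
    (x₀ := z₀) (s := ball z₀ ρ) (bound := fun _ => M) (ball_mem_nhds z₀ hρ)
    (by filter_upwards [hU.mem_nhds hz₀] with z hz using (hcont F hF z hz).aestronglyMeasurable)
    ((hcont F hF z₀ hz₀).intervalIntegrable _ _)
    (hcont F' hF' z₀ hz₀).aestronglyMeasurable
    (.of_forall fun θ _ z hz => hM (z, circleMap c R θ)
      ⟨ball_subset_closedBall hz, circleMap_mem_sphere' c R θ⟩)
    intervalIntegrable_const
    (.of_forall fun θ _ z hz => hd z (hρU (ball_subset_closedBall hz)) _
      (circleMap_mem_sphere' c R θ))).2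
  exact (key.const_smul ((2 * Real.pi)⁻¹ : ℝ)).differentiableAt.differentiableWithinAt

theorem norm_circleAverage_le {f : ℂ → ℂ} {c : ℂ} {R M : ℝ}
    (h : ∀ z ∈ sphere c |R|, ‖f z‖ ≤ M) : ‖Real.circleAverage f c R‖ ≤ M := by
  have := intervalIntegral.norm_integral_le_of_norm_le_const (a := 0) (b := 2 * Real.pi)
    (f := fun θ => f (circleMap c R θ)) (C := M) fun θ _ => h _ (circleMap_mem_sphere' c R θ)
  rw [sub_zero, abs_of_pos Real.two_pi_pos] at this
  rw [Real.circleAverage, norm_smul, norm_inv, Real.norm_of_nonneg Real.two_pi_pos.le,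
    inv_mul_le_iff₀ Real.two_pi_pos]
  linarith

open ComplexConjugate in
/-- If `S` is holomorphic, the Fourier coefficients of `a * conj S` vanish in degrees larger than
the degree of `a`. -/
theorem circleAverage_conj_eq_zero {S : ℂ → ℂ} {R : ℝ} (hR : 0 < R)
    (hS : DifferentiableOn ℂ S (closedBall 0 R)) (a : ℂ[X]) {k : ℕ} (hk : a.natDegree < k) :
    Real.circleAverage (fun z => (z ^ k)⁻¹ * (a.eval z * conj (S z))) 0 R = 0 := by
  -- On |z| = R the conjugate of z is R²/z, so `G` is the conjugate of the integrand there. It is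
  -- holomorphic and vanishes at 0 because every exponent k - l is positive; the mean value property
  -- concludes.
  set G : ℂ → ℂ := fun z => ∑ l ∈ Finset.range (a.natDegree + 1),
    conj (a.coeff l) * ((R : ℂ) ^ (2 * (k - l)))⁻¹ * z ^ (k - l) * S z with hG
  have hGd : DifferentiableOn ℂ G (closedBall 0 R) := by
    intro z hz
    have := hS z hz
    simp only [hG]
    fun_prop
  have hcongr : Real.circleAverage (fun z => (z ^ k)⁻¹ * (a.eval z * conj (S z))) 0 R =
      Real.circleAverage (Complex.conjCLE.toContinuousLinearMap ∘ G) 0 R := by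
    refine Real.circleAverage_congr_sphere fun z hz => ?_
    rw [abs_of_pos hR] at hz
    have hzR : ‖z‖ = R := by simpa using hz
    have hz0 : z ≠ 0 := by rintro rfl; simp at hzR; linarith
    have hR0 : (R : ℂ) ≠ 0 := by exact_mod_cast hR.ne'
    have hconj : conj z = (R : ℂ) ^ 2 / z := by
      rw [eq_div_iff hz0, mul_comm, Complex.mul_conj, Complex.normSq_eq_norm_sq, hzR]
      push_cast; rfl
    simp only [Function.comp_apply, hG, ContinuousLinearEquiv.coe_coe, Complex.conjCLE_apply,
      map_sum, map_mul, map_pow, map_inv₀, Complex.conj_conj, Complex.conj_ofReal, hconj]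
    rw [eval_eq_sum_range, Finset.sum_mul, Finset.mul_sum]
    refine Finset.sum_congr rfl fun l hl => ?_
    obtain ⟨m, rfl⟩ : ∃ m, k = l + m := ⟨k - l, by have := Finset.mem_range.1 hl; omega⟩
    rw [Nat.add_sub_cancel_left, div_pow]
    field_simp
    ring
  rw [hcongr, ContinuousLinearMap.circleAverage_comp_comm]
  · have hd : DiffContOnCl ℂ G (ball 0 |R|) := by
      rw [abs_of_pos hR]
      exact (hGd.mono closure_ball_subset_closedBall).diffContOnCl
    rw [hd.circleAverage]
    have hG0 : G 0 = 0 := Finset.sum_eq_zero fun l hl => by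
      have := Finset.mem_range.1 hl
      rw [zero_pow (by omega)]
      ring
    simp [hG0]
  · exact (hGd.continuousOn.mono sphere_subset_closedBall).circleIntegrable hR.le

open ComplexConjugate in
/-- A holomorphic function on the disc which is asymptotic at the boundary to `a * conj S`, with
`S` holomorphic and `a` a polynomial, is a polynomial. -/
theorem exists_polynomial_eqOn {F S : ℂ → ℂ} (hF : DifferentiableOn ℂ F (ball 0 1))
    (hS : DifferentiableOn ℂ S (ball 0 1)) (a : ℂ[X])
    (h : ∀ ε > 0, ∃ r < (1 : ℝ), ∀ z : ℂ, r < ‖z‖ → ‖z‖ < 1 →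
      ‖F z - a.eval z * conj (S z)‖ ≤ ε) :
    ∃ Q : ℂ[X], ∀ z : ℂ, ‖z‖ < 1 → F z = Q.eval z := by
  have hps : ∀ R : NNReal, 0 < R → R < 1 →
      HasFPowerSeriesOnBall F (cauchyPowerSeries F 0 R) 0 R := fun R h0 h1 =>
    (hF.mono (closedBall_subset_ball (by exact_mod_cast h1))).hasFPowerSeriesOnBall h0
  have huniq : ∀ R R' : NNReal, 0 < R → R < 1 → 0 < R' → R' < 1 →
      cauchyPowerSeries F 0 R = cauchyPowerSeries F 0 R' := fun R R' h0 h1 h0' h1' =>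
    (hps R h0 h1).hasFPowerSeriesAt.eq_formalMultilinearSeries (hps R' h0' h1').hasFPowerSeriesAt
  -- The radius 1/2 is only a reference: Taylor coefficients do not depend on it.
  set c : ℕ → ℂ := fun k => (cauchyPowerSeries F 0 (1 / 2 : NNReal)) k fun _ => 1 with hc
  have hhalf : (1 / 2 : NNReal) < 1 := by
    rw [← NNReal.coe_lt_coe]; push_cast; norm_num
  have hcR : ∀ (R : NNReal) (k : ℕ), 0 < R → R < 1 →
      c k = Real.circleAverage (fun z => (z ^ k)⁻¹ * F z) 0 R := by
    intro R k h0 h1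
    rw [hc, huniq _ R (by positivity) hhalf h0 h1]
    simp only
    rw [cauchyPowerSeries_apply, Real.circleAverage_eq_circleIntegral (by exact_mod_cast h0.ne')]
    congr 2
    funext z
    simp only [sub_zero, smul_eq_mul, one_div, inv_pow]
    ring
  have hzero : ∀ k, a.natDegree < k → c k = 0 := by
    intro k hk
    rw [← norm_le_zero_iff]
    refine le_of_forall_pos_le_add fun ε hε => ?_
    -- The factor 2^k absorbs R^(-k), since R will exceed 1/2.
    obtain ⟨r, hr, hb⟩ := h (ε / 2 ^ k) (by positivity)
    obtain ⟨R, hR1, hR2⟩ := exists_between (max_lt hr (by norm_num : (1 / 2 : ℝ) < 1))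
    have hR0 : (1 / 2 : ℝ) < R := (le_max_right _ _).trans_lt hR1
    have hRr : r < R := (le_max_left _ _).trans_lt hR1
    lift R to NNReal using by linarith
    have hRp : (0 : ℝ) < R := by linarith
    have hsub : closedBall (0 : ℂ) R ⊆ ball 0 1 := closedBall_subset_ball hR2
    have hsph : sphere (0 : ℂ) R ⊆ ball 0 1 := sphere_subset_closedBall.trans hsub
    have hinv : ContinuousOn (fun z : ℂ => (z ^ k)⁻¹) (sphere 0 R) := by
      refine ContinuousOn.inv₀ (by fun_prop) fun z hz => pow_ne_zero _ ?_
      rintro rfl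
      simp at hz
      linarith
    have h1 : CircleIntegrable (fun z => (z ^ k)⁻¹ * F z) 0 R :=
      (hinv.mul (hF.continuousOn.mono hsph)).circleIntegrable hRp.le
    have h2 : CircleIntegrable (fun z => (z ^ k)⁻¹ * (a.eval z * conj (S z))) 0 R :=
      (hinv.mul (a.continuous.continuousOn.mul
        (Complex.continuous_conj.comp_continuousOn (hS.continuousOn.mono hsph)))).circleIntegrable
        hRp.le
    have hsubeq := Real.circleAverage_fun_sub h1 h2
    rw [circleAverage_conj_eq_zero hRp (hS.mono hsub) a hk, sub_zero,
      ← hcR R k (by exact_mod_cast hRp) (by exact_mod_cast hR2)] at hsubeq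
    rw [← hsubeq, zero_add]
    refine norm_circleAverage_le fun z hz => ?_
    have hzR : ‖z‖ = R := by simpa using hz
    rw [← mul_sub, norm_mul, norm_inv, norm_pow, hzR]
    have := hb z (by rw [hzR]; exact hRr) (by rw [hzR]; exact hR2)
    have h3 : ((R : ℝ) ^ k)⁻¹ ≤ 2 ^ k := by
      rw [← inv_pow]
      refine pow_le_pow_left₀ (by positivity) ?_ k
      rw [inv_le_comm₀ hRp two_pos]
      linarith
    calc _ ≤ 2 ^ k * (ε / 2 ^ k) := mul_le_mul h3 this (norm_nonneg _) (by positivity)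
      _ = ε := by field_simp
  refine ⟨∑ k ∈ Finset.range (a.natDegree + 1), Polynomial.C (c k) * Polynomial.X ^ k,
    fun z hz => ?_⟩
  obtain ⟨R, hR1, hR2⟩ := exists_between (max_lt hz (by norm_num : (1 / 2 : ℝ) < 1))
  lift R to NNReal using le_trans (by positivity) hR1.le
  have hRz : ‖z‖ < R := (le_max_left _ _).trans_lt hR1
  have hRp : (0 : ℝ) < R := (norm_nonneg z).trans_lt hRz
  have hsum := (hps R (by exact_mod_cast hRp) (by exact_mod_cast hR2)).hasSum (y := z)
    (by simpa [← NNReal.coe_lt_coe] using hRz)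
  rw [huniq R (1 / 2) (by exact_mod_cast hRp) (by exact_mod_cast hR2) (by positivity) hhalf,
    zero_add] at hsum
  have hterm : ∀ k, ((cauchyPowerSeries F 0 (1 / 2 : NNReal)) k fun _ => z) = c k * z ^ k := by
    intro k
    rw [FormalMultilinearSeries.apply_eq_pow_smul_coeff, smul_eq_mul, mul_comm]
    rfl
  simp only [hterm] at hsum
  have hsum' : HasSum (fun k => c k * z ^ k)
      (∑ k ∈ Finset.range (a.natDegree + 1), c k * z ^ k) :=
    hasSum_sum_of_ne_finset_zero fun k hk => by
      rw [hzero k (by simpa using hk), zero_mul]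
  rw [hsum.unique hsum']
  simp [eval_finsetSum]

end Analysis

/-! ### Sums over the roots in the disc, by the argument principle. -/

section Trace

/-- The average of `w g(w) p'(w) / p(w)` over the unit circle is the sum of `g` over the roots of
`p` in the unit disc. -/
theorem sum_roots_eq_circleAverage {p : ℂ[X]} (hp : ∀ w, ‖w‖ = 1 → p.eval w ≠ 0) {g : ℂ → ℂ}
    (hg : Differentiable ℂ g) :
    ((p.roots.filter (‖·‖ < 1)).map g).sum =
      Real.circleAverage (fun w => w * (g w * (derivative p).eval w / p.eval w)) 0 1 := by
  -- The logarithmic derivative splits as Σ 1/(w - a): Cauchy's formula gives g(a) for a inside, and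
  -- 0 for a outside. The factor w turns dθ into dw/i.
  have key : ∀ s : Multiset ℂ, (∀ a ∈ s, ‖a‖ ≠ 1) →
      CircleIntegrable (fun w => (s.map fun a => w * (g w / (w - a))).sum) 0 1 ∧
      Real.circleAverage (fun w => (s.map fun a => w * (g w / (w - a))).sum) 0 1 =
        ((s.filter (‖·‖ < 1)).map g).sum := by
    intro s
    induction s using Multiset.induction_on with
    | empty => intro _; simp [Real.circleAverage_const]
    | cons a s ih =>
      intro hs
      obtain ⟨hi, he⟩ := ih fun b hb => hs b (Multiset.mem_cons_of_mem hb)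
      have ha : ‖a‖ ≠ 1 := hs a (Multiset.mem_cons_self a s)
      have hia : CircleIntegrable (fun w => w * (g w / (w - a))) 0 1 := by
        refine ContinuousOn.circleIntegrable zero_le_one ?_
        refine continuousOn_id.mul (hg.continuous.continuousOn.div (by fun_prop) fun w hw => ?_)
        rintro h
        rw [sub_eq_zero] at h
        subst h
        exact ha (by simpa using hw)
      have hva : Real.circleAverage (fun w => w * (g w / (w - a))) 0 1 =
          if ‖a‖ < 1 then g a else 0 := by
        split_ifs with h
        · have := hg.diffContOnCl.circleAverage_smul_div (c := 0) (R := 1) (w := a) (by simpa using h)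
          rw [← this]
          congr 1
          funext w
          simp only [sub_zero, smul_eq_mul]
          ring
        · have hlt : 1 < ‖a‖ := lt_of_le_of_ne (not_lt.1 h) ha.symm
          have hd : DiffContOnCl ℂ (fun w => w * (g w / (w - a))) (ball 0 |1|) := by
            rw [abs_one]
            refine DifferentiableOn.diffContOnCl fun w hw => ?_
            have hwa : w - a ≠ 0 := by
              rintro h
              rw [sub_eq_zero] at h
              subst h
              have := closure_ball_subset_closedBall hw
              simp at this
              linarith
            exact (differentiableAt_id.mul ((hg w).div (by fun_prop) hwa)).differentiableWithinAt
          rw [hd.circleAverage, zero_mul]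
      simp only [Multiset.map_cons, Multiset.sum_cons]
      refine ⟨hia.add hi, ?_⟩
      rw [Real.circleAverage_fun_add hia hi, hva, he]
      split_ifs with h
      · rw [Multiset.filter_cons_of_pos (p := fun x : ℂ => ‖x‖ < 1) _ h, Multiset.map_cons,
          Multiset.sum_cons]
      · rw [Multiset.filter_cons_of_neg (p := fun x : ℂ => ‖x‖ < 1) _ h, zero_add]
  rw [← (key p.roots fun a ha h => hp a h (isRoot_of_mem_roots ha)).2]
  refine Real.circleAverage_congr_sphere fun w hw => ?_
  have hw1 : ‖w‖ = 1 := by simpa using hw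
  rw [mul_div_assoc, (IsAlgClosed.splits p).eval_derivative_div_eval_of_ne_zero (hp w hw1),
    ← mul_assoc, ← Multiset.sum_map_mul_left]
  congr 2
  funext a
  ring

/-- The roots of `P(z, ·)` in the unit disc, with multiplicity. -/
noncomputable def discRoots (P : ℂ[X][Y]) (z : ℂ) : Multiset ℂ :=
  (slice P z).roots.filter (‖·‖ < 1)

/-- The sum of `g(z, ·)` over the roots of `P(z, ·)` in the unit disc. -/
noncomputable def discTrace (P g : ℂ[X][Y]) (z : ℂ) : ℂ :=
  ((discRoots P z).map (g.evalEval z)).sum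

theorem mem_discRoots {P : ℂ[X][Y]} {z w : ℂ} (hne : slice P z ≠ 0) :
    w ∈ discRoots P z ↔ P.evalEval z w = 0 ∧ ‖w‖ < 1 := by
  rw [discRoots, Multiset.mem_filter, mem_roots hne, IsRoot, eval_slice]

theorem differentiableOn_discTrace {P : ℂ[X][Y]}
    (hP : ∀ z w, ‖z‖ < 1 → ‖w‖ = 1 → P.evalEval z w ≠ 0) (g : ℂ[X][Y]) :
    DifferentiableOn ℂ (discTrace P g) (ball 0 1) := by
  -- The trace is the circle average of w·A/P, whose denominator has no zero on the circle; `D` is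
  -- ∂/∂z.
  set A := g * derivative P with hA
  set D : ℂ[X][Y] → ℂ[X][Y] := fun p => Bivariate.swap (derivative (Bivariate.swap p))
  have hP' : ∀ x ∈ ball (0 : ℂ) 1 ×ˢ sphere (0 : ℂ) |1|, P.evalEval x.1 x.2 ≠ 0 := fun x hx =>
    hP _ _ (by simpa using hx.1) (by simpa using hx.2)
  have hcont : ∀ Q : ℂ[X][Y], ContinuousOn (fun x : ℂ × ℂ => Q.evalEval x.1 x.2)
      (ball (0 : ℂ) 1 ×ˢ sphere (0 : ℂ) |1|) := fun Q => (continuous_evalEval Q).continuousOn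
  have key := differentiableOn_circleAverage (U := ball 0 1) isOpen_ball (c := 0) (R := 1)
    (F := fun z w => w * (A.evalEval z w / P.evalEval z w))
    (F' := fun z w => w * (((D A).evalEval z w * P.evalEval z w
      - A.evalEval z w * (D P).evalEval z w) / P.evalEval z w ^ 2))
    (continuousOn_snd.mul ((hcont A).div (hcont P) hP'))
    (continuousOn_snd.mul ((((hcont _).mul (hcont P)).sub ((hcont A).mul (hcont _))).div
      ((hcont P).pow 2) fun x hx => pow_ne_zero _ (hP' x hx)))
    fun z hz w hw => ((hasDerivAt_evalEval_left A z w).div (hasDerivAt_evalEval_left P z w)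
      (hP' (z, w) ⟨hz, hw⟩)).const_mul w
  refine key.congr fun z hz => ?_
  have hgd : Differentiable ℂ (g.evalEval z) := by simpa using (slice g z).differentiable
  rw [discTrace, discRoots, sum_roots_eq_circleAverage (fun w hw => ?_) hgd]
  · simp only [eval_derivative_slice, eval_slice, hA, evalEval_mul]
  · rw [eval_slice]
    exact hP z w (by simpa using hz) hw

/-- The number of roots of `P(z, ·)` in the disc does not depend on `z`. -/
theorem card_discRoots_eq {P : ℂ[X][Y]}
    (hP : ∀ z w, ‖z‖ < 1 → ‖w‖ = 1 → P.evalEval z w ≠ 0) {z z' : ℂ} (hz : ‖z‖ < 1)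
    (hz' : ‖z'‖ < 1) : (discRoots P z).card = (discRoots P z').card := by
  -- The trace of g = 1 is the count: continuous and integer-valued on a connected disc.
  have hc : ContinuousOn (fun z => (discRoots P z).card) (ball 0 1) := by
    rw [Nat.isClosedEmbedding_coe_real.isInducing.continuousOn_iff]
    refine (Complex.continuous_re.comp_continuousOn
      (differentiableOn_discTrace hP 1).continuousOn).congr fun z _ => ?_
    simp [discTrace]
  exact (convex_ball (0 : ℂ) 1).isPreconnected.constant hc (by simpa using hz) (by simpa using hz')

end Trace

/-! ### Moments, Hankel systems and Bézout relations. -/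

section Algebra

/-- A polynomial weighted moment problem has only the trivial solution. -/
theorem eval_eq_zero_of_moments (s : Multiset ℂ) (u : ℂ[X])
    (h : ∀ l < s.card, (s.map fun v => u.eval v * v ^ l).sum = 0) : ∀ v ∈ s, u.eval v = 0 := by
  intro v₀ hv₀
  have hpoly : ∀ L : ℂ[X], L.natDegree < s.card → (s.map fun v => u.eval v * L.eval v).sum = 0 := by
    intro L hL
    have : ∀ v, u.eval v * L.eval v =
        ∑ l ∈ Finset.range (L.natDegree + 1), L.coeff l * (u.eval v * v ^ l) := fun v => by
      rw [eval_eq_sum_range (p := L), Finset.mul_sum]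
      exact Finset.sum_congr rfl fun l _ => by ring
    simp only [this, Multiset.sum_map_sum, Multiset.sum_map_mul_left]
    refine Finset.sum_eq_zero fun l hl => ?_
    rw [h l (by have := Finset.mem_range.1 hl; omega), mul_zero]
  have hv₀' : v₀ ∈ s.toFinset := Multiset.mem_toFinset.2 hv₀
  -- Lagrange interpolation: testing against `L` isolates v₀, whose multiplicity is nonzero in ℂ.
  set L : ℂ[X] := ∏ v ∈ s.toFinset.erase v₀, (Polynomial.X - Polynomial.C v) with hL
  have hdeg : L.natDegree < s.card := by
    rw [hL, natDegree_finsetProd_X_sub_C_eq_card]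
    exact (Finset.card_erase_lt_of_mem hv₀').trans_le (Multiset.toFinset_card_le s)
  have hsum := hpoly L hdeg
  rw [Finset.sum_multiset_map_count, Finset.sum_eq_single_of_mem v₀ hv₀'] at hsum
  · rw [nsmul_eq_mul, mul_eq_zero, mul_eq_zero] at hsum
    rcases hsum with hsum | hsum | hsum
    · rw [Nat.cast_eq_zero, Multiset.count_eq_zero] at hsum
      exact absurd hv₀ hsum
    · exact hsum
    · rw [hL, Polynomial.eval_prod, Finset.prod_eq_zero_iff] at hsum
      obtain ⟨v, hv, hv0⟩ := hsum
      rw [Polynomial.eval_sub, Polynomial.eval_X, Polynomial.eval_C, sub_eq_zero] at hv0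
      exact absurd hv0.symm (Finset.ne_of_mem_erase hv)
  · intro v hv hne
    have : L.eval v = 0 := by
      rw [hL, Polynomial.eval_prod]
      exact Finset.prod_eq_zero (Finset.mem_erase.2 ⟨hne, hv⟩) (by simp)
    rw [this, mul_zero, smul_zero]

/-- Nontrivial solutions of a Hankel system with more unknowns than equations. -/
theorem exists_hankel_relation {R : Type*} [CommRing R] [IsDomain R] (Q : ℕ → R) (N : ℕ) :
    ∃ c : Fin (N + 1) → R, c ≠ 0 ∧ ∀ l < N, ∑ j : Fin (N + 1), c j * Q (j + l) = 0 := by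
  -- A zero row makes the system square with zero determinant; the solution then exists over the
  -- domain itself.
  set M : Matrix (Fin (N + 1)) (Fin (N + 1)) R := fun l j => if (l : ℕ) < N then Q (j + l) else 0
  have hdet : M.det = 0 := Matrix.det_eq_zero_of_row_eq_zero (Fin.last N) fun j => by simp [M]
  obtain ⟨c, hc, hMc⟩ := Matrix.exists_mulVec_eq_zero_iff.2 hdet
  refine ⟨c, hc, fun l hl => ?_⟩
  have := congrFun hMc ⟨l, by omega⟩
  simpa [M, Matrix.mulVec, dotProduct, hl, mul_comm] using this

/-- A Bézout relation, without denominators, between an irreducible `P` and a nonzero `G` of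
smaller degree. -/
theorem exists_bezout {R : Type*} (K : Type*) [CommRing R] [IsDomain R] [NormalizedGCDMonoid R]
    [Field K] [Algebra R K] [IsFractionRing R K] {P G : R[X]} (hP : Irreducible P) (hG : G ≠ 0)
    (hdeg : G.natDegree < P.natDegree) :
    ∃ d ≠ 0, ∃ a b : R[X], a * P + b * G = Polynomial.C d := by
  set φ := algebraMap R K
  have hφ : Function.Injective φ := IsFractionRing.injective R K
  -- Gauss's lemma.
  have hirr : Irreducible (P.map φ) :=
    ((hP.isPrimitive (by omega)).irreducible_iff_irreducible_map_fraction_map (K := K)).1 hP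
  have hcop : IsCoprime (P.map φ) (G.map φ) := by
    refine (hirr.coprime_iff_not_dvd).2 fun hdvd => ?_
    have := natDegree_le_of_dvd hdvd ((Polynomial.map_ne_zero_iff hφ).2 hG)
    rw [natDegree_map_eq_of_injective hφ, natDegree_map_eq_of_injective hφ] at this
    omega
  obtain ⟨a, b, hab⟩ := hcop
  obtain ⟨α, hα0, hα⟩ := IsLocalization.integerNormalization_spec (nonZeroDivisors R) a
  obtain ⟨β, hβ0, hβ⟩ := IsLocalization.integerNormalization_spec (nonZeroDivisors R) b
  set a' := IsLocalization.integerNormalization (nonZeroDivisors R) a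
  set b' := IsLocalization.integerNormalization (nonZeroDivisors R) b
  refine ⟨α * β, mul_ne_zero (nonZeroDivisors.ne_zero hα0) (nonZeroDivisors.ne_zero hβ0),
    Polynomial.C β * a', Polynomial.C α * b', ?_⟩
  apply Polynomial.map_injective φ hφ
  have h1 : a'.map φ = Polynomial.C (φ α) * a := by
    rw [hα, ← algebraMap_smul K α a, Polynomial.smul_eq_C_mul]
  have h2 : b'.map φ = Polynomial.C (φ β) * b := by
    rw [hβ, ← algebraMap_smul K β b, Polynomial.smul_eq_C_mul]
  simp only [Polynomial.map_add, Polynomial.map_mul, Polynomial.map_C, h1, h2, map_mul]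
  linear_combination (Polynomial.C (φ α) * Polynomial.C (φ β)) * hab

end Algebra

/-! ### Irreducible polynomials whose zeros exit through the torus. -/

section Bidisk

/-- The zeros of `P` in the open bidisk. -/
def bidiskZeros (P : ℂ[X][Y]) : Set (ℂ × ℂ) :=
  {x | ‖x.1‖ < 1 ∧ ‖x.2‖ < 1 ∧ P.evalEval x.1 x.2 = 0}

/-- The zeros of `P` in the bidisk approach its boundary only along the torus. -/
def ExitsThroughTorus (P : ℂ[X][Y]) : Prop :=
  ∀ x ∈ closure (bidiskZeros P), ‖x.1‖ = 1 ↔ ‖x.2‖ = 1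

theorem mem_bidiskZeros_swap {P : ℂ[X][Y]} {x : ℂ × ℂ} :
    x ∈ bidiskZeros (Bivariate.swap P) ↔ x.swap ∈ bidiskZeros P := by
  simp only [bidiskZeros, Set.mem_ofPred_eq, evalEval_swap, Prod.fst_swap, Prod.snd_swap]
  tauto

theorem ExitsThroughTorus.swap {P : ℂ[X][Y]} (h : ExitsThroughTorus P) :
    ExitsThroughTorus (Bivariate.swap P) := fun x hx =>
  (h x.swap (map_mem_closure continuous_swap hx fun _ hy => mem_bidiskZeros_swap.1 hy)).symm

theorem closure_bidiskZeros_subset (P : ℂ[X][Y]) :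
    closure (bidiskZeros P) ⊆ closedBall 0 1 ×ˢ closedBall 0 1 :=
  closure_minimal (fun x hx => by
    simpa using ⟨hx.1.le, hx.2.1.le⟩) (isClosed_closedBall.prod isClosed_closedBall)

/-- Otherwise `P` is z - z₀ up to a unit. Its zero set is then a vertical line meeting the bidisk,
which exits at (z₀,1) with |z₀| < 1. -/
theorem slice_ne_zero {P : ℂ[X][Y]} (hP : Irreducible P) (hne : (bidiskZeros P).Nonempty)
    (hex : ExitsThroughTorus P) (z₀ : ℂ) : slice P z₀ ≠ 0 := by
  intro h0
  have hdvd : Polynomial.C (Polynomial.X - Polynomial.C z₀) ∣ P := by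
    rw [Polynomial.C_dvd_iff_dvd_coeff]
    intro n
    rw [dvd_iff_isRoot, IsRoot]
    simpa [slice] using congrArg (fun q => Polynomial.coeff q n) h0
  obtain ⟨u, hu⟩ := hdvd
  have hunit : IsUnit u := (hP.isUnit_or_isUnit hu).resolve_left fun h =>
    (Polynomial.irreducible_X_sub_C z₀).not_isUnit (Polynomial.isUnit_C.1 h)
  have hzero : ∀ z w, P.evalEval z w = 0 ↔ z = z₀ := fun z w => by
    have : u.evalEval z w ≠ 0 := (hunit.map (evalEvalRingHom z w)).ne_zero
    rw [hu, evalEval_mul, evalEval_C]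
    simp [this, sub_eq_zero]
  obtain ⟨x, hx1, -, hx⟩ := hne
  rw [hzero] at hx
  have hmem : (z₀, (1 : ℂ)) ∈ closure (bidiskZeros P) := by
    refine map_mem_closure (f := fun w : ℂ => (z₀, w)) (s := ball 0 1) (by fun_prop) ?_
      fun w hw => ⟨hx ▸ hx1, by simpa using hw, (hzero _ _).2 rfl⟩
    rw [closure_ball _ one_ne_zero]
    simp
  have := (hex _ hmem).2 (by simp)
  simp only at this
  rw [← hx] at this
  linarith

theorem irreducible_swap {P : ℂ[X][Y]} (hP : Irreducible P) : Irreducible (Bivariate.swap P) :=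
  (MulEquiv.irreducible_iff (Bivariate.swap (R := ℂ))).2 hP

theorem bidiskZeros_swap_nonempty {P : ℂ[X][Y]} (h : (bidiskZeros P).Nonempty) :
    (bidiskZeros (Bivariate.swap P)).Nonempty := by
  obtain ⟨x, hx⟩ := h
  exact ⟨x.swap, mem_bidiskZeros_swap.2 (by simpa using hx)⟩

/-- `P` has no zeros in the product of the open disc and the circle. -/
theorem evalEval_ne_zero {P : ℂ[X][Y]} (hP : Irreducible P) (hne : (bidiskZeros P).Nonempty)
    (hex : ExitsThroughTorus P) (z w : ℂ) (hz : ‖z‖ < 1) (hw : ‖w‖ = 1) :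
    P.evalEval z w ≠ 0 := by
  intro h0
  have hs := slice_ne_zero (irreducible_swap hP) (bidiskZeros_swap_nonempty hne) hex.swap w
  -- Move w slightly into the disc; a zero in the first variable follows and stays in the disc.
  have hmem : (z, w) ∈ closure (bidiskZeros P) := by
    rw [Metric.mem_closure_iff]
    intro ε hε
    have hnear := exists_zero_near hs (w₀ := z) (by rwa [evalEval_swap])
      (lt_min hε (sub_pos.2 hz))
    have hfreq : ∃ᶠ w' in 𝓝 w, w' ∈ ball (0 : ℂ) 1 := by
      rw [← mem_closure_iff_frequently, closure_ball _ one_ne_zero]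
      simp [hw]
    obtain ⟨w', hw', ⟨z', hz', h0'⟩, hd⟩ :=
      (hfreq.and_eventually (hnear.and (ball_mem_nhds w hε))).exists
    rw [evalEval_swap] at h0'
    refine ⟨(z', w'), ⟨?_, by simpa using hw', h0'⟩, ?_⟩
    · have h1 := (lt_min_iff.1 hz').2
      have h2 := norm_le_norm_add_norm_sub' z' z
      rw [dist_eq_norm] at h1
      simp only
      linarith
    · rw [dist_comm, Prod.dist_eq]
      exact max_lt (lt_min_iff.1 hz').1 hd
  have := (hex _ hmem).2 hw
  simp only at this
  linarith

/-- Along the zeros in the bidisk, `|w|` tends to `1` uniformly as `|z|` tends to `1`. -/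
theorem exists_lt_norm_of_mem_bidiskZeros {P : ℂ[X][Y]} (hex : ExitsThroughTorus P) {t : ℝ}
    (ht : t < 1) : ∃ r < (1 : ℝ), ∀ x ∈ bidiskZeros P, r < ‖x.1‖ → t < ‖x.2‖ := by
  -- On this compact set |z| never equals 1, so its maximum is below 1.
  set K := closure (bidiskZeros P) ∩ {x | ‖x.2‖ ≤ t}
  have hK : IsCompact K := by
    refine IsCompact.inter_right ?_ (isClosed_le (by fun_prop) continuous_const)
    exact ((isCompact_closedBall (0 : ℂ) 1).prod (isCompact_closedBall (0 : ℂ) 1)).of_isClosed_subset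
      isClosed_closure (closure_bidiskZeros_subset P)
  rcases K.eq_empty_or_nonempty with he | hne
  · refine ⟨0, zero_lt_one, fun x hx _ => ?_⟩
    by_contra hle
    exact (he ▸ (⟨subset_closure hx, not_lt.1 hle⟩ : x ∈ K) : x ∈ (∅ : Set (ℂ × ℂ)))
  · obtain ⟨y, hy, hmax⟩ := hK.exists_isMaxOn hne
      (f := fun x : ℂ × ℂ => ‖x.1‖) (by fun_prop)
    refine ⟨‖y.1‖, ?_, fun x hx hlt => ?_⟩
    · have h1 : ‖y.1‖ ≤ 1 := by simpa using (closure_bidiskZeros_subset P hy.1).1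
      refine lt_of_le_of_ne h1 fun h => ?_
      have h2 := (hex y hy.1).1 h
      have h3 : ‖y.2‖ ≤ t := hy.2
      linarith
    · by_contra hle
      have : ‖x.1‖ ≤ ‖y.1‖ := hmax (⟨subset_closure hx, not_lt.1 hle⟩ : x ∈ K)
      linarith

theorem norm_multiset_map_sum_le {s : Multiset ℂ} {f : ℂ → ℂ} {B : ℝ} (h : ∀ x ∈ s, ‖f x‖ ≤ B) :
    ‖(s.map f).sum‖ ≤ s.card * B := by
  induction s using Multiset.induction_on with
  | empty => simp
  | cons a s ih =>
    rw [Multiset.map_cons, Multiset.sum_cons, Multiset.card_cons]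
    have h1 := h a (Multiset.mem_cons_self a s)
    have h2 := ih fun x hx => h x (Multiset.mem_cons_of_mem hx)
    push_cast
    linarith [norm_add_le (f a) (s.map f).sum]

/-- This makes `-P.divX` a polynomial representative of P(z,0)/w on the zero set, bounded even where
w = 0. -/
theorem mul_neg_divX_evalEval {P : ℂ[X][Y]} {z w : ℂ} (h : P.evalEval z w = 0) :
    w * (-P.divX).evalEval z w = (P.coeff 0).eval z := by
  have := congrArg (evalEval z w) (divX_mul_X_add P)
  rw [h, evalEval_add, evalEval_mul, evalEval_X, evalEval_C] at this
  rw [evalEval_neg]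
  linear_combination -this

open ComplexConjugate in
/-- The power sums of `P(z, 0) / w`, over the zeros `w` of `P(z, ·)` in the disc, are polynomials
in `z`. -/
theorem exists_polynomial_discTrace {P : ℂ[X][Y]} (hP : Irreducible P)
    (hne : (bidiskZeros P).Nonempty) (hex : ExitsThroughTorus P) (j : ℕ) :
    ∃ Q : ℂ[X], ∀ z : ℂ, ‖z‖ < 1 → discTrace P ((-P.divX) ^ j) z = Q.eval z := by
  have hnz := evalEval_ne_zero hP hne hex
  set h := -P.divX with hh
  obtain ⟨M, hM⟩ := ((isCompact_closedBall (0 : ℂ) 1).prod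
    (isCompact_closedBall (0 : ℂ) 1)).exists_bound_of_continuousOn (continuous_evalEval h).continuousOn
  refine exists_polynomial_eqOn (differentiableOn_discTrace hnz _)
    (differentiableOn_discTrace hnz (Polynomial.X ^ j)) (P.coeff 0 ^ j) fun ε hε => ?_
  set N := (discRoots P 0).card
  -- Each of the N zeros with |w| > t contributes an error |h|^j (1 - |w|^(2j)), at most M^j (1 -
  -- t^(2j)).
  obtain ⟨t, ht0, ht1, htε⟩ : ∃ t : ℝ, 0 < t ∧ t < 1 ∧ N * (M ^ j * (1 - (t ^ 2) ^ j)) < ε := by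
    have hc : Continuous fun t : ℝ => N * (M ^ j * (1 - (t ^ 2) ^ j)) := by fun_prop
    have h1 : ∀ᶠ t in 𝓝[<] (1 : ℝ), N * (M ^ j * (1 - (t ^ 2) ^ j)) < ε :=
      nhdsWithin_le_nhds (hc.continuousAt.eventually (gt_mem_nhds (by simpa using hε)))
    obtain ⟨t, hta, htb⟩ := (h1.and (Ioo_mem_nhdsLT (zero_lt_one' ℝ))).exists
    exact ⟨t, htb.1, htb.2, hta⟩
  obtain ⟨r, hr, hrt⟩ := exists_lt_norm_of_mem_bidiskZeros hex ht1
  refine ⟨r, hr, fun z hz hz1 => ?_⟩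
  have hdiff : discTrace P (h ^ j) z - (P.coeff 0 ^ j).eval z *
      conj (discTrace P (Polynomial.X ^ j) z) =
      ((discRoots P z).map fun w => h.evalEval z w ^ j -
        (P.coeff 0).eval z ^ j * conj (w ^ j)).sum := by
    rw [Multiset.sum_map_sub, Multiset.sum_map_mul_left, discTrace, discTrace, map_multiset_sum,
      Multiset.map_map, Polynomial.eval_pow]
    simp [evalEval_pow]
  rw [hdiff]
  have hcard : (discRoots P z).card = N := card_discRoots_eq hnz hz1 (by simp)
  have hbound : ∀ w ∈ discRoots P z, ‖h.evalEval z w ^ j -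
      (P.coeff 0).eval z ^ j * conj (w ^ j)‖ ≤ M ^ j * (1 - (t ^ 2) ^ j) := by
    intro w hw
    rw [mem_discRoots (slice_ne_zero hP hne hex z)] at hw
    have htw : t < ‖w‖ := hrt (z, w) ⟨hz1, hw.2, hw.1⟩ hz
    rw [← mul_neg_divX_evalEval hw.1, ← hh, map_pow]
    have heq : h.evalEval z w ^ j - (w * h.evalEval z w) ^ j * conj w ^ j =
        h.evalEval z w ^ j * ((1 - (‖w‖ ^ 2) ^ j : ℝ) : ℂ) := by
      have : ((‖w‖ ^ 2 : ℝ) : ℂ) = w * conj w := by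
        rw [Complex.mul_conj, Complex.normSq_eq_norm_sq]
      push_cast at this ⊢
      rw [this]
      ring
    have hle : (‖w‖ ^ 2) ^ j ≤ 1 := pow_le_one₀ (by positivity) (pow_le_one₀ (by positivity) hw.2.le)
    have hge : (t ^ 2) ^ j ≤ (‖w‖ ^ 2) ^ j := by gcongr
    have hMz : ‖h.evalEval z w‖ ≤ M :=
      hM (z, w) ⟨by simpa using hz1.le, by simpa using hw.2.le⟩
    rw [heq, norm_mul, norm_pow, Complex.norm_real, Real.norm_of_nonneg (by linarith)]
    exact mul_le_mul (pow_le_pow_left₀ (norm_nonneg _) hMz j) (by linarith) (by linarith)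
      (pow_nonneg ((norm_nonneg _).trans hMz) j)
  exact (norm_multiset_map_sum_le hbound).trans (hcard ▸ htε.le)

/-- The number of zeros of `P(z, ·)` in the disc is at least the degree of `P` in `w`. -/
theorem natDegree_le_card_discRoots {P : ℂ[X][Y]} (hP : Irreducible P)
    (hne : (bidiskZeros P).Nonempty) (hex : ExitsThroughTorus P) :
    P.natDegree ≤ (discRoots P 0).card := by
  have hnz := evalEval_ne_zero hP hne hex
  have hs := slice_ne_zero hP hne hex
  set N := (discRoots P 0).card
  have hcard : ∀ z, ‖z‖ < 1 → (discRoots P z).card = N := fun z hz =>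
    card_discRoots_eq hnz hz (by simp)
  have hN : 0 < N := by
    obtain ⟨x, hx1, hx2, hx⟩ := hne
    rw [← hcard x.1 hx1]
    exact Multiset.card_pos_iff_exists_mem.2 ⟨x.2, (mem_discRoots (hs _)).2 ⟨hx, hx2⟩⟩
  by_contra! hlt
  set h := -P.divX with hh
  set a := P.coeff 0 with ha
  -- If a = 0, then P(·,0) vanishes identically, which `slice_ne_zero` excludes after exchanging the
  -- variables.
  have ha0 : a ≠ 0 := by
    intro h0
    refine slice_ne_zero (irreducible_swap hP) (bidiskZeros_swap_nonempty hne) hex.swap 0 ?_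
    refine Polynomial.funext fun z => ?_
    rw [eval_slice, evalEval_swap, evalEval, Polynomial.C_0, ← coeff_zero_eq_eval_zero, ← ha, h0]
  choose Q hQ using exists_polynomial_discTrace hP hne hex
  obtain ⟨c, hc, hcQ⟩ := exists_hankel_relation Q N
  -- At fixed z, the Hankel equations say that Σ c_j X^j has N vanishing weighted moments over the N
  -- values of h.
  have hrel : ∀ z w, ‖z‖ < 1 → w ∈ discRoots P z →
      ∑ j : Fin (N + 1), (c j).eval z * h.evalEval z w ^ (j : ℕ) = 0 := by
    intro z w hz hw
    have := eval_eq_zero_of_moments ((discRoots P z).map (h.evalEval z))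
      (∑ j : Fin (N + 1), Polynomial.C ((c j).eval z) * Polynomial.X ^ (j : ℕ)) (fun l hl => ?_)
      (h.evalEval z w) (Multiset.mem_map_of_mem _ hw)
    · simpa [Polynomial.eval_finsetSum] using this
    · rw [Multiset.card_map, hcard z hz] at hl
      have hl' := congrArg (Polynomial.eval z) (hcQ l hl)
      simp only [Polynomial.eval_finsetSum, Polynomial.eval_mul, ← hQ _ z hz,
        Polynomial.eval_zero] at hl'
      rw [← hl', Multiset.map_map]
      simp only [Function.comp_def, Polynomial.eval_finsetSum, Polynomial.eval_mul,
        Polynomial.eval_C, Polynomial.eval_pow, Polynomial.eval_X, Finset.sum_mul,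
        Multiset.sum_map_sum, discTrace, ← Multiset.sum_map_mul_left, evalEval_pow]
      refine Finset.sum_congr rfl fun j _ => ?_
      congr 2
      funext x
      ring
  -- This is w^N Σ c_j (a/w)^j, cleared of denominators.
  set G : ℂ[X][Y] := ∑ j : Fin (N + 1),
    Polynomial.C (c j * a ^ (j : ℕ)) * Polynomial.X ^ (N - (j : ℕ)) with hG
  have hGdeg : G.natDegree ≤ N :=
    natDegree_sum_le_of_forall_le _ _ fun j _ =>
      (natDegree_C_mul_X_pow_le _ _).trans (Nat.sub_le _ _)
  have hG0 : G ≠ 0 := by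
    obtain ⟨j₀, hj₀⟩ := Function.ne_iff.1 hc
    intro h0
    have h1 := congrArg (fun q => Polynomial.coeff q (N - (j₀ : ℕ))) h0
    simp only [hG, finsetSum_coeff, Polynomial.coeff_C_mul, Polynomial.coeff_X_pow,
      Polynomial.coeff_zero] at h1
    rw [Finset.sum_eq_single_of_mem j₀ (Finset.mem_univ _)] at h1
    · rw [if_pos rfl, mul_one] at h1
      exact mul_ne_zero hj₀ (pow_ne_zero _ ha0) h1
    · intro j _ hj
      rw [if_neg, mul_zero]
      intro heq
      exact hj (Fin.ext (by omega))
  -- Common zeros of `P` and `G` above every z in the disc force d = 0.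
  obtain ⟨d, hd, A, B, hAB⟩ := exists_bezout (FractionRing ℂ[X]) hP hG0 (hGdeg.trans_lt hlt)
  refine hd (Polynomial.eq_zero_of_infinite_isRoot d
    ((infinite_of_mem_nhds (0 : ℂ) (ball_mem_nhds 0 one_pos)).mono fun z hz => ?_))
  have hz1 : ‖z‖ < 1 := by simpa using hz
  obtain ⟨w, hw⟩ := Multiset.card_pos_iff_exists_mem.1 (hN.trans_eq (hcard z hz1).symm)
  have hPw := ((mem_discRoots (hs z)).1 hw).1
  have hGw : G.evalEval z w = 0 := by
    have : G.evalEval z w =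
        w ^ N * ∑ j : Fin (N + 1), (c j).eval z * h.evalEval z w ^ (j : ℕ) := by
      rw [hG, evalEval_finsetSum, Finset.mul_sum]
      refine Finset.sum_congr rfl fun j _ => ?_
      rw [evalEval_mul, evalEval_C, evalEval_pow, evalEval_X, Polynomial.eval_mul,
        Polynomial.eval_pow, ha, ← mul_neg_divX_evalEval hPw, ← hh, mul_pow]
      have : w ^ N = w ^ (j : ℕ) * w ^ (N - (j : ℕ)) := by
        rw [← pow_add]
        congr 1
        omega
      rw [this]
      ring
    rw [this, hrel z w hz1 hw, mul_zero]
  have := congrArg (evalEval z w) hAB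
  simpa [hPw, hGw, evalEval_C] using this.symm

/-- Over the disc, all zeros of `P` lie in the bidisk. -/
theorem norm_snd_lt_one {P : ℂ[X][Y]} (hP : Irreducible P)
    (hne : (bidiskZeros P).Nonempty) (hex : ExitsThroughTorus P) {z w : ℂ} (hz : ‖z‖ < 1)
    (h0 : P.evalEval z w = 0) : ‖w‖ < 1 := by
  have hs := slice_ne_zero hP hne hex z
  -- P(z,·) has at most deg_w P roots, and at least that many lie in the disc.
  have heq : discRoots P z = (slice P z).roots := by
    refine Multiset.eq_of_le_of_card_le (Multiset.filter_le _ _) ?_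
    rw [card_discRoots_eq (evalEval_ne_zero hP hne hex) hz (by simp : ‖(0 : ℂ)‖ < 1)]
    exact (card_roots' _).trans (natDegree_map_le.trans (natDegree_le_card_discRoots hP hne hex))
  have hw : w ∈ discRoots P z := by
    rw [heq, mem_roots hs, IsRoot, eval_slice, h0]
  exact ((mem_discRoots hs).1 hw).2

theorem norm_fst_lt_one {P : ℂ[X][Y]} (hP : Irreducible P)
    (hne : (bidiskZeros P).Nonempty) (hex : ExitsThroughTorus P) {z w : ℂ} (hw : ‖w‖ < 1)
    (h0 : P.evalEval z w = 0) : ‖z‖ < 1 :=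
  norm_snd_lt_one (irreducible_swap hP) (bidiskZeros_swap_nonempty hne) hex.swap hw
    (by rwa [evalEval_swap])

/-- A zero with |w| > 1 would persist above nearby points of the open disc. -/
theorem norm_snd_le_one {P : ℂ[X][Y]} (hP : Irreducible P)
    (hne : (bidiskZeros P).Nonempty) (hex : ExitsThroughTorus P) {z w : ℂ} (hz : ‖z‖ = 1)
    (h0 : P.evalEval z w = 0) : ‖w‖ ≤ 1 := by
  by_contra! hw
  have hfreq : ∃ᶠ z' in 𝓝 z, z' ∈ ball (0 : ℂ) 1 := by
    rw [← mem_closure_iff_frequently, closure_ball _ one_ne_zero]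
    simp [hz]
  obtain ⟨z', hz', w', hw', h0'⟩ := (hfreq.and_eventually
    (exists_zero_near (slice_ne_zero hP hne hex z) h0 (sub_pos.2 hw))).exists
  have h1 := norm_snd_lt_one hP hne hex (by simpa using hz') h0'
  have h2 := norm_le_norm_add_norm_sub' w w'
  rw [dist_comm, dist_eq_norm] at hw'
  linarith

theorem norm_fst_le_one {P : ℂ[X][Y]} (hP : Irreducible P)
    (hne : (bidiskZeros P).Nonempty) (hex : ExitsThroughTorus P) {z w : ℂ} (hw : ‖w‖ = 1)
    (h0 : P.evalEval z w = 0) : ‖z‖ ≤ 1 :=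
  norm_snd_le_one (irreducible_swap hP) (bidiskZeros_swap_nonempty hne) hex.swap hw
    (by rwa [evalEval_swap])

end Bidisk

/-! ### Reduction to irreducible factors, and the converse. -/

section Main

theorem evalEval_equivMvPolynomial_symm (p : MvPolynomial (Fin 2) ℂ) (z w : ℂ) :
    ((Bivariate.equivMvPolynomial ℂ).symm p).evalEval z w = MvPolynomial.eval ![z, w] p := by
  obtain ⟨P, rfl⟩ := (Bivariate.equivMvPolynomial ℂ).surjective p
  rw [AlgEquiv.symm_apply_apply]
  have h : (MvPolynomial.aeval ![z, w]).comp (Bivariate.equivMvPolynomial ℂ).toAlgHom =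
      aevalAeval (R := ℂ) z w := by
    ext <;> simp
  have := DFunLike.congr_fun h P
  rw [coe_aevalAeval_eq_evalEval] at this
  rw [← this]
  simp

theorem mem_disk {z : ℂ} : z ∈ disk ↔ ‖z‖ < 1 := by simp [disk]

theorem mem_circle {z : ℂ} : z ∈ circle ↔ ‖z‖ = 1 := by simp [circle]

theorem mem_exterior {z : ℂ} : z ∈ exterior ↔ 1 < ‖z‖ := by simp [exterior]

theorem frontier_disk : frontier disk = circle := frontier_ball 0 one_ne_zero

theorem closure_disk : closure disk = closedBall 0 1 := closure_ball 0 one_ne_zero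

theorem mem_frontier_bidisk {x : ℂ × ℂ} :
    x ∈ frontier bidisk ↔ ‖x.1‖ ≤ 1 ∧ ‖x.2‖ = 1 ∨ ‖x.1‖ = 1 ∧ ‖x.2‖ ≤ 1 := by
  rw [bidisk, frontier_prod_eq, frontier_disk, closure_disk]
  simp [mem_circle]

theorem bidiskZeros_eq (p : MvPolynomial (Fin 2) ℂ) :
    bidiskZeros ((Bivariate.equivMvPolynomial ℂ).symm p) = {x ∈ bidisk | x ∈ zeroSet p} := by
  ext x
  simp [bidiskZeros, bidisk, zeroSet, mem_disk, evalEval_equivMvPolynomial_symm, and_assoc]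

theorem zeroSet_subset_of_irreducible {q : MvPolynomial (Fin 2) ℂ} (hq : Irreducible q)
    (hne : {x ∈ bidisk | x ∈ zeroSet q}.Nonempty)
    (hcl : closure {x ∈ bidisk | x ∈ zeroSet q} ∩ frontier bidisk ⊆ circle ×ˢ circle) :
    zeroSet q ⊆ disk ×ˢ disk ∪ circle ×ˢ circle ∪ exterior ×ˢ exterior := by
  rw [← bidiskZeros_eq] at hne hcl
  set P := (Bivariate.equivMvPolynomial ℂ).symm q with hP
  have hirr : Irreducible P :=
    (MulEquiv.irreducible_iff (Bivariate.equivMvPolynomial ℂ).symm).2 hq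
  have hex : ExitsThroughTorus P := by
    intro x hx
    obtain ⟨h1, h2⟩ := closure_bidiskZeros_subset P hx
    rw [mem_closedBall_zero_iff] at h1 h2
    constructor
    · intro h
      exact mem_circle.1 (hcl ⟨hx, mem_frontier_bidisk.2 (.inr ⟨h, h2⟩)⟩).2
    · intro h
      exact mem_circle.1 (hcl ⟨hx, mem_frontier_bidisk.2 (.inl ⟨h1, h⟩)⟩).1
  rintro ⟨z, w⟩ hx
  have h0 : P.evalEval z w = 0 := by
    rw [hP, evalEval_equivMvPolynomial_symm]
    exact hx
  simp only [Set.mem_union, Set.mem_prod, mem_disk, mem_circle, mem_exterior]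
  rcases lt_trichotomy ‖z‖ 1 with hz | hz | hz
  · exact .inl (.inl ⟨hz, norm_snd_lt_one hirr hne hex hz h0⟩)
  · have h1 := norm_snd_le_one hirr hne hex hz h0
    refine .inl (.inr ⟨hz, le_antisymm h1 (not_lt.1 fun hw => ?_)⟩)
    exact hz.not_lt (norm_fst_lt_one hirr hne hex hw h0)
  · refine .inr ⟨hz, ?_⟩
    rcases lt_trichotomy ‖w‖ 1 with hw | hw | hw
    · exact absurd (norm_fst_lt_one hirr hne hex hw h0) hz.not_gt
    · exact absurd (norm_fst_le_one hirr hne hex hw h0) hz.not_ge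
    · exact hw

theorem isUnit_of_bidegree_eq_zero {q : MvPolynomial (Fin 2) ℂ} (hq : q ≠ 0)
    (h : bidegree q = 0) : IsUnit q := by
  have h0 : q.degreeOf 0 = 0 := congrArg Prod.fst h
  have h1 : q.degreeOf 1 = 0 := congrArg Prod.snd h
  have ht : q.totalDegree = 0 := by
    rw [totalDegree_eq_zero_iff]
    intro m hm i
    fin_cases i
    · exact Nat.le_zero.1 (h0 ▸ monomial_le_degreeOf 0 hm)
    · exact Nat.le_zero.1 (h1 ▸ monomial_le_degreeOf 1 hm)
  rw [totalDegree_eq_zero_iff_eq_C] at ht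
  rw [ht] at hq ⊢
  exact (isUnit_iff_ne_zero.2 fun h => hq (by rw [h, MvPolynomial.C_0])).map MvPolynomial.C

/-- The whole bidisk is not distinguished: its closure contains (0,1). -/
theorem CutsOut.ne_zero {p : MvPolynomial (Fin 2) ℂ} {V : Set (ℂ × ℂ)}
    (hV : IsDistinguishedVariety V) (hp : CutsOut p V) : p ≠ 0 := by
  rintro rfl
  have hVb : V = bidisk := by
    rw [CutsOut] at hp
    rw [hp]
    ext x
    simp [zeroSet]
  have hmem : ((0 : ℂ), (1 : ℂ)) ∈ closure V ∩ frontier bidisk := by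
    refine ⟨?_, mem_frontier_bidisk.2 (.inl (by simp))⟩
    rw [hVb, bidisk, closure_prod_eq, closure_disk]
    simp
  rw [hV.2.2, frontier_disk] at hmem
  simpa using mem_circle.1 hmem.2.1

/-- A factor without zeros in the bidisk could be cancelled. By additivity of degrees, minimality
would then make its bidegree zero, so it would be a unit. -/
theorem CutsOutMinimally.nonempty_of_irreducible_dvd {p q : MvPolynomial (Fin 2) ℂ}
    {V : Set (ℂ × ℂ)} (hp0 : p ≠ 0) (hp : CutsOutMinimally p V) (hq : Irreducible q)
    (hdvd : q ∣ p) : {x ∈ bidisk | x ∈ zeroSet q}.Nonempty := by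
  by_contra hempty
  rw [Set.not_nonempty_iff_eq_empty] at hempty
  obtain ⟨c, rfl⟩ := hdvd
  have hc0 : c ≠ 0 := right_ne_zero_of_mul hp0
  have hcut : CutsOut c V := by
    have h : V = {x ∈ bidisk | x ∈ zeroSet (q * c)} := hp.1
    rw [CutsOut, h]
    ext x
    refine and_congr_right fun hx => ?_
    have hqx : MvPolynomial.eval ![x.1, x.2] q ≠ 0 := fun h =>
      (Set.eq_empty_iff_forall_notMem.1 hempty x) ⟨hx, h⟩
    simp [zeroSet, hqx]
  have hdeg : bidegree (q * c) = bidegree q + bidegree c := by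
    simp only [bidegree, degreeOf_mul_eq hq.ne_zero hc0, Prod.mk_add_mk]
  have hle := hp.2 hcut (by rw [hdeg]; exact le_add_of_nonneg_left zero_le)
  rw [hdeg] at hle
  refine hq.not_isUnit (isUnit_of_bidegree_eq_zero hq.ne_zero ?_)
  exact le_antisymm (le_of_add_le_add_right (hle.trans_eq (zero_add _).symm)) zero_le

theorem zeroSet_subset {V : Set (ℂ × ℂ)} {p : MvPolynomial (Fin 2) ℂ}
    (hV : IsDistinguishedVariety V) (hp : CutsOutMinimally p V) :
    zeroSet p ⊆ disk ×ˢ disk ∪ circle ×ˢ circle ∪ exterior ×ˢ exterior := by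
  have hp0 : p ≠ 0 := CutsOut.ne_zero hV hp.1
  intro x hx
  obtain ⟨f, hf, u, hu⟩ := WfDvdMonoid.exists_factors p hp0
  have h0 : MvPolynomial.eval ![x.1, x.2] f.prod = 0 := by
    have h : MvPolynomial.eval ![x.1, x.2] p = 0 := hx
    rw [← hu, map_mul] at h
    exact (mul_eq_zero.1 h).resolve_right (u.isUnit.map (MvPolynomial.eval ![x.1, x.2])).ne_zero
  rw [map_multiset_prod, Multiset.prod_eq_zero_iff, Multiset.mem_map] at h0
  obtain ⟨q, hq, hqx⟩ := h0
  have hdvd : q ∣ p := (Multiset.dvd_prod hq).trans ⟨u, hu.symm⟩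
  refine zeroSet_subset_of_irreducible (hf q hq)
    (hp.nonempty_of_irreducible_dvd hp0 (hf q hq) hdvd) ?_ hqx
  have hsub : {x ∈ bidisk | x ∈ zeroSet q} ⊆ V := by
    have h : V = {x ∈ bidisk | x ∈ zeroSet p} := hp.1
    rw [h]
    rintro y ⟨hy, hy0⟩
    have h : MvPolynomial.eval ![y.1, y.2] q = 0 := hy0
    exact ⟨hy, zero_dvd_iff.1 (h ▸ map_dvd (MvPolynomial.eval ![y.1, y.2]) hdvd)⟩
  rintro y ⟨hy, hyf⟩
  have : y ∈ closure V ∩ frontier bidisk := ⟨closure_mono hsub hy, hyf⟩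
  rw [hV.2.2, frontier_disk] at this
  exact this.2

theorem zeroSet_inter_bidisk_nonempty {p : MvPolynomial (Fin 2) ℂ} (hne : (zeroSet p).Nonempty)
    (hsub : zeroSet p ⊆ disk ×ˢ disk ∪ circle ×ˢ circle ∪ exterior ×ˢ exterior) :
    (zeroSet p ∩ disk ×ˢ disk).Nonempty := by
  set P := (Bivariate.equivMvPolynomial ℂ).symm p with hP
  have hsub' : ∀ z w, P.evalEval z w = 0 →
      (‖z‖ < 1 ∧ ‖w‖ < 1 ∨ ‖z‖ = 1 ∧ ‖w‖ = 1) ∨ 1 < ‖z‖ ∧ 1 < ‖w‖ := by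
    intro z w h
    have := hsub (show (z, w) ∈ zeroSet p by
      rw [hP, evalEval_equivMvPolynomial_symm] at h
      exact h)
    simpa only [Set.mem_union, Set.mem_prod, mem_disk, mem_circle, mem_exterior] using this
  -- A zero at w = 0 forces |z| < 1, while one at w = 2 forces |z| > 1.
  have hfiber : ∀ z, ¬ ∀ w, P.evalEval z w = 0 := by
    intro z h
    have h1 := hsub' z 0 (h 0)
    have h2 := hsub' z 2 (h 2)
    norm_num at h1 h2
    linarith
  by_contra hempty
  rw [Set.not_nonempty_iff_eq_empty] at hempty
  have hnoroot : ∀ z w, ‖z‖ < 1 → P.evalEval z w ≠ 0 := by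
    intro z w hz h
    have hw : ‖w‖ < 1 := by
      rcases hsub' z w h with (h | h) | h
      · exact h.2
      · linarith [h.1]
      · linarith [h.1]
    rw [hP, evalEval_equivMvPolynomial_symm] at h
    exact Set.eq_empty_iff_forall_notMem.1 hempty (z, w) ⟨h, mem_disk.2 hz, mem_disk.2 hw⟩
  -- A rootless polynomial over ℂ is constant, so the higher coefficients vanish on the disc, hence
  -- identically.
  have hcoeff : ∀ k, k ≠ 0 → P.coeff k = 0 := by
    intro k hk
    refine Polynomial.eq_zero_of_infinite_isRoot _
      ((infinite_of_mem_nhds (0 : ℂ) (ball_mem_nhds 0 one_pos)).mono fun z hz => ?_)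
    have hdeg : (slice P z).degree = 0 := by
      by_contra hd
      obtain ⟨w, hw⟩ := IsAlgClosed.exists_root _ hd
      exact hnoroot z w (by simpa using hz) (by rwa [IsRoot, eval_slice] at hw)
    have := Polynomial.coeff_eq_zero_of_natDegree_lt (p := slice P z) (n := k)
      (by rw [natDegree_eq_zero_iff_degree_le_zero.2 hdeg.le]; omega)
    simpa [slice] using this
  have hPC : P = Polynomial.C (P.coeff 0) := by
    ext1 k
    rw [Polynomial.coeff_C]
    split_ifs with h
    · rw [h]
    · exact hcoeff k h
  obtain ⟨⟨z, w⟩, hzw⟩ := hne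
  have h0 : P.evalEval z w = 0 := by
    rw [hP, evalEval_equivMvPolynomial_symm]
    exact hzw
  rw [hPC, evalEval_C] at h0
  exact hfiber z fun w' => by rw [hPC, evalEval_C, h0]

theorem isClosed_zeroSet (p : MvPolynomial (Fin 2) ℂ) : IsClosed (zeroSet p) := by
  have h := continuous_evalEval ((Bivariate.equivMvPolynomial ℂ).symm p)
  simp only [evalEval_equivMvPolynomial_symm] at h
  exact isClosed_eq h continuous_const

theorem isDistinguishedVariety_zeroSet_inter {p : MvPolynomial (Fin 2) ℂ}
    (hne : (zeroSet p).Nonempty)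
    (hsub : zeroSet p ⊆ disk ×ˢ disk ∪ circle ×ˢ circle ∪ exterior ×ˢ exterior) :
    IsDistinguishedVariety (zeroSet p ∩ disk ×ˢ disk) := by
  refine ⟨zeroSet_inter_bidisk_nonempty hne hsub, ⟨p, Set.inter_comm _ _⟩, ?_⟩
  ext x
  rw [frontier_disk]
  refine and_congr_right fun hx => ?_
  have hxz : x ∈ zeroSet p := closure_minimal Set.inter_subset_left (isClosed_zeroSet p) hx
  have := hsub hxz
  simp only [Set.mem_union, Set.mem_prod, mem_disk, mem_circle, mem_exterior] at this
  rw [mem_frontier_bidisk, Set.mem_prod, mem_circle, mem_circle]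
  constructor
  · rintro (h | h) <;> rcases this with (h' | h') | h' <;> constructor <;>
      linarith [h.1, h.2, h'.1, h'.2]
  · rintro ⟨h1, h2⟩
    exact .inl ⟨h1.le, h2⟩

end Main

end DistVar

theorem mainTheorem6 :
    (∀ (V : Set (ℂ × ℂ)) (p : MvPolynomial (Fin 2) ℂ),
      DistVar.IsDistinguishedVariety V → DistVar.CutsOutMinimally p V →
        DistVar.zeroSet p ⊆ DistVar.disk ×ˢ DistVar.disk ∪ DistVar.circle ×ˢ DistVar.circle ∪
          DistVar.exterior ×ˢ DistVar.exterior) ∧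
    (∀ p : MvPolynomial (Fin 2) ℂ, (DistVar.zeroSet p).Nonempty →
      DistVar.zeroSet p ⊆ DistVar.disk ×ˢ DistVar.disk ∪ DistVar.circle ×ˢ DistVar.circle ∪
          DistVar.exterior ×ˢ DistVar.exterior →
        DistVar.IsDistinguishedVariety (DistVar.zeroSet p ∩ DistVar.disk ×ˢ DistVar.disk)) :=
  ⟨fun _ _ hV hp => DistVar.zeroSet_subset hV hp,
    fun _ hne hsub => DistVar.isDistinguishedVariety_zeroSet_inter hne hsub⟩
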